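/- A skew left brace (brace, for short) is a set $B$ with two group structures $(B,+)$ and $(B,\cdot)$, neither assumed commutative, such that $a(b+c)=ab-a+ac$ for all $a,b,c\in B$; put $\lambda_a(b)=-a+ab$. An ideal of $B$ is a subset that is a normal subgroup of both $(B,+)$ and $(B,\cdot)$ and is mapped into itself by every $\lambda_b$, $b\in B$. Let $\operatorname{Soc}(B)=\{a\in B:\ \lambda_a(b)=b \text{ and } a+b=b+a \text{ for all } b\in B\}$. The brace $B$ is supersoluble if there is a finite chain of ideals of $B$ $$\{0\}=I_0\le I_1\le\cdots\le I_n=B$$ such that, for every $0\le i<n$, either $(I_{i+1}/I_i,+)$ is infinite cyclic and $I_{i+1}/I_i\le\operatorname{Soc}(B/I_i)$, or $I_{i+1}/I_i$ has prime order. For a prime $p$, let $U_p^+(B)$ (resp. $U_p^{\cdot}(B)$) be the set of all elements of $B$ whose order in $(B,+)$ (resp. in $(B,\cdot)$) is finite and divisible only by primes $q>p$. Let $B$ be a supersoluble brace. 1. For every prime $p$, $U_p^+(B)=U_p^{\cdot}(B)$, and this set is an ideal of $B$. 2. If $B$ is finite, $q_1>q_2>\cdots>q_n$ are the distinct primes dividing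 $|B|$, and $P_i$ is any Sylow $q_i$-subgroup of $(B,+)$ for $1\le i\le n$, then $P_1+P_2+\cdots+P_k=\{x_1+\cdots+x_k:\ x_i\in P_i\}$ is an ideal of $B$ for every $0\le k\le n$ (the empty sum being $\{0\}$). 3. The set of all elements of $(B,+)$ of finite odd order is an ideal of $B$. -/

import Mathlib

open scoped Pointwise

/-- A skew left brace: two group structures on the same set, written additively (not necessarily
commutative) and multiplicatively, with `a (b + c) = a b - a + a c`. -/
class SkewLeftBrace (B : Type*) extends AddGroup B, Group B where
  brace_mul_add : ∀ a b c : B, a * (b + c) = a * b + -a + a * c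

namespace SkewLeftBrace

section Basic

variable {B : Type*} [SkewLeftBrace B]

/-- The lambda map `λ_a(b) = -a + a b`. -/
def lam (a b : B) : B := -a + a * b

/-- The socle: the kernel of `λ` intersected with the centre of the additive group. -/
def socle (B : Type*) [SkewLeftBrace B] : Set B :=
  {a | (∀ b : B, lam a b = b) ∧ ∀ b : B, a + b = b + a}

theorem lam_add (a b c : B) : lam a (b + c) = lam a b + lam a c := by
  simp only [lam, brace_mul_add, add_assoc]

theorem mul_zero_brace (a : B) : a * (0 : B) = a := by
  have h := brace_mul_add a (0 : B) 0
  rw [add_zero, add_assoc, left_eq_add] at h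
  exact (neg_add_eq_zero.mp h).symm

theorem lam_zero (a : B) : lam a (0 : B) = 0 := by
  rw [lam, mul_zero_brace, neg_add_cancel]

theorem lam_neg (a b : B) : lam a (-b) = -lam a b := by
  have h := lam_add a (-b) b
  rw [neg_add_cancel, lam_zero] at h
  exact eq_neg_of_add_eq_zero_left h.symm

theorem zero_eq_one_brace : (0 : B) = 1 := by
  simpa using mul_zero_brace (1 : B)

theorem lam_inv_neg_add (a b : B) : lam a⁻¹ (-a + b) = a⁻¹ * b := by
  rw [lam_add, lam_neg, lam, lam, inv_mul_cancel, ← zero_eq_one_brace, add_zero, neg_neg,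
    add_neg_cancel_left]

theorem lam_inv_mul (a b : B) : lam a (a⁻¹ * b) = -a + b := by
  rw [lam, mul_inv_cancel_left]

end Basic

/-- A subbrace: a subset that is a subgroup of both groups. -/
structure Subbrace (B : Type*) [SkewLeftBrace B] extends AddSubgroup B, Subgroup B

/-- An ideal: a subbrace that is invariant under all `λ_b`, normal in the additive group, and
normal in the multiplicative group. -/
structure BraceIdeal (B : Type*) [SkewLeftBrace B] extends Subbrace B where
  lam_mem : ∀ b x : B, x ∈ carrier → lam b x ∈ carrier
  add_conj_mem : ∀ b x : B, x ∈ carrier → b + x + -b ∈ carrier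
  mul_conj_mem : ∀ b x : B, x ∈ carrier → b * x * b⁻¹ ∈ carrier

/-- A subset is an ideal. -/
def IsBraceIdeal {B : Type*} [SkewLeftBrace B] (S : Set B) : Prop :=
  ∃ I : BraceIdeal B, I.carrier = S

namespace BraceIdeal

variable {B : Type*} [SkewLeftBrace B] (I : BraceIdeal B)

/-- The additive group of an ideal. -/
abbrev add : AddSubgroup B := I.toSubbrace.toAddSubgroup

/-- The multiplicative group of an ideal. -/
abbrev mul : Subgroup B := I.toSubbrace.toSubgroup

instance : I.add.Normal := ⟨fun x hx b => I.add_conj_mem b x hx⟩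

instance : I.mul.Normal := ⟨fun x hx b => I.mul_conj_mem b x hx⟩

theorem mem_mul_iff (a : B) : a ∈ I.mul ↔ a ∈ I.add := Iff.rfl

/-- The additive and multiplicative (left) cosets of an ideal agree. -/
theorem inv_mul_mem_iff (a b : B) : a⁻¹ * b ∈ I.mul ↔ -a + b ∈ I.add := by
  constructor
  · intro h
    rw [← lam_inv_mul]
    exact I.lam_mem _ _ h
  · intro h
    rw [← lam_inv_neg_add]
    exact I.lam_mem _ _ h

/-- The set of cosets `b + I = b I`. -/
def Quotient : Type _ := B ⧸ I.add

instance : AddGroup I.Quotient := inferInstanceAs (AddGroup (B ⧸ I.add))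

/-- The projection onto the quotient, as a homomorphism of additive groups. -/
def proj : B →+ I.Quotient := QuotientAddGroup.mk' I.add

theorem proj_surjective : Function.Surjective I.proj := QuotientAddGroup.mk'_surjective I.add

theorem proj_eq_iff (a b : B) : I.proj a = I.proj b ↔ a⁻¹ * b ∈ I.mul := by
  rw [inv_mul_mem_iff]
  exact QuotientAddGroup.eq

theorem proj_eq_iff_quotient (a b : B) :
    I.proj a = I.proj b ↔ (QuotientGroup.mk a : B ⧸ I.mul) = QuotientGroup.mk b := by
  rw [proj_eq_iff, QuotientGroup.eq]

theorem proj_mul_congr {a a' b b' : B} (h : I.proj a = I.proj a') (h' : I.proj b = I.proj b') :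
    I.proj (a * b) = I.proj (a' * b') := by
  rw [proj_eq_iff_quotient] at *
  rw [QuotientGroup.mk_mul, QuotientGroup.mk_mul, h, h']

theorem proj_inv_congr {a a' : B} (h : I.proj a = I.proj a') : I.proj a⁻¹ = I.proj a'⁻¹ := by
  rw [proj_eq_iff_quotient] at *
  rw [QuotientGroup.mk_inv, QuotientGroup.mk_inv, h]

theorem proj_eq_of_rel {a b : B} (h : QuotientAddGroup.leftRel I.add a b) :
    I.proj a = I.proj b := Quotient.sound h

instance : Mul I.Quotient :=
  ⟨_root_.Quotient.map₂ (fun a b : B => a * b) fun _ _ h _ _ h' =>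
    _root_.Quotient.exact (I.proj_mul_congr (I.proj_eq_of_rel h) (I.proj_eq_of_rel h'))⟩

instance : Inv I.Quotient :=
  ⟨_root_.Quotient.map (fun a : B => a⁻¹) fun _ _ h =>
    _root_.Quotient.exact (I.proj_inv_congr (I.proj_eq_of_rel h))⟩

instance : One I.Quotient := ⟨I.proj 1⟩

theorem proj_mul (a b : B) : I.proj (a * b) = I.proj a * I.proj b := rfl

theorem proj_inv (a : B) : I.proj a⁻¹ = (I.proj a)⁻¹ := rfl

theorem proj_one : I.proj 1 = 1 := rfl

instance : Group I.Quotient :=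
  Group.ofLeftAxioms
    (by
      intro x y z
      obtain ⟨a, rfl⟩ := I.proj_surjective x
      obtain ⟨b, rfl⟩ := I.proj_surjective y
      obtain ⟨c, rfl⟩ := I.proj_surjective z
      simp only [← proj_mul, mul_assoc])
    (by
      intro x
      obtain ⟨a, rfl⟩ := I.proj_surjective x
      rw [← proj_one, ← proj_mul, one_mul])
    (by
      intro x
      obtain ⟨a, rfl⟩ := I.proj_surjective x
      rw [← proj_inv, ← proj_mul, inv_mul_cancel, proj_one])

/-- The quotient brace `B / I`, with operations induced from representatives. -/
instance : SkewLeftBrace I.Quotient where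
  brace_mul_add := by
    intro x y z
    obtain ⟨a, rfl⟩ := I.proj_surjective x
    obtain ⟨b, rfl⟩ := I.proj_surjective y
    obtain ⟨c, rfl⟩ := I.proj_surjective z
    have h := congrArg I.proj (brace_mul_add a b c)
    simpa only [map_add, map_neg, proj_mul] using h

/-- The factor `J / I` as a subgroup of the additive group of `B / I`. -/
def factor (I J : BraceIdeal B) : AddSubgroup I.Quotient := J.add.map I.proj

end BraceIdeal

/-- A brace is supersoluble if it has a finite chain `{0} = I 0 ≤ I 1 ≤ ... ≤ I n = B` of ideals
such that each factor `I (i + 1) / I i` either is additively infinite cyclic and contained in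
`Soc (B / I i)`, or has prime order. -/
def IsSupersoluble (B : Type*) [SkewLeftBrace B] : Prop :=
  ∃ (n : ℕ) (I : ℕ → BraceIdeal B),
    (I 0).carrier = {0} ∧ (I n).carrier = Set.univ ∧
    ∀ i < n, (I i).carrier ⊆ (I (i + 1)).carrier ∧
      ((IsAddCyclic ((I i).factor (I (i + 1))) ∧ Infinite ((I i).factor (I (i + 1))) ∧
          ((I i).factor (I (i + 1)) : Set (I i).Quotient) ⊆ socle (I i).Quotient) ∨
        (Nat.card ((I i).factor (I (i + 1)))).Prime)

/-- Elements whose additive order is finite and divisible only by primes `q > p`. -/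
def UAdd (B : Type*) [SkewLeftBrace B] (p : ℕ) : Set B :=
  {x | IsOfFinAddOrder x ∧ ∀ q : ℕ, q.Prime → q ∣ addOrderOf x → p < q}

/-- Elements whose multiplicative order is finite and divisible only by primes `q > p`. -/
def UMul (B : Type*) [SkewLeftBrace B] (p : ℕ) : Set B :=
  {x | IsOfFinOrder x ∧ ∀ q : ℕ, q.Prime → q ∣ orderOf x → p < q}

/-- The underlying set of a Sylow `q`-subgroup of the additive group of `B`. -/
def addSylowSet {B : Type*} [SkewLeftBrace B] {q : ℕ} (P : Sylow q (Multiplicative B)) : Set B :=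
  {x | Multiplicative.ofAdd x ∈ P}

end SkewLeftBrace

/-! Descend the chain from `B` to `0`, keeping over each term `K` an ideal `J` such that `J/K` is
finite, of order divisible only by primes above `p`, and contains every element of `B/K` whose
additive or multiplicative order is of that kind. At the bottom, `J` equals both `UAdd B p` and
`UMul B p`.

For one step, divide by the next term, so that `K` has prime order or is infinite cyclic inside the
socle, and put `m = |J : K|`. If `|K|` is a prime above `p`, then `J` still works. Otherwise
conjugation and `λ` make `J` act on the cyclic group `K` through automorphisms of order prime to
`|Aut K|`, hence trivially (`fixes_of_iterate_fixes`). So `K` is additively central in `J`, and by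
transfer `x ↦ m • x` is additive on `J`; triviality of `λ` makes it multiplicative as well. Its
kernel is the new ideal (`exists_of_trivial_action`).

The odd-order claim is the case `p = 2`. In the finite case, the partial Sylow sums are the sets
`UAdd B (q k)`, or all of `B`. -/

/-- A nonzero natural number all of whose prime divisors are greater than `p`. -/
def PrimesAbove (p m : ℕ) : Prop :=
  m ≠ 0 ∧ ∀ q : ℕ, q.Prime → q ∣ m → p < q

namespace PrimesAbove

variable {p m n : ℕ}

theorem one : PrimesAbove p 1 :=
  ⟨one_ne_zero, fun _ hq h => absurd (Nat.dvd_one.mp h) hq.ne_one⟩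

theorem mul (hm : PrimesAbove p m) (hn : PrimesAbove p n) : PrimesAbove p (m * n) :=
  ⟨mul_ne_zero hm.1 hn.1, fun q hq h =>
    (hq.dvd_mul.mp h).elim (hm.2 q hq) (hn.2 q hq)⟩

theorem of_dvd (hn : PrimesAbove p n) (h : m ∣ n) : PrimesAbove p m :=
  ⟨ne_zero_of_dvd_ne_zero hn.1 h, fun q hq h' => hn.2 q hq (h'.trans h)⟩

theorem of_prime (hm : m.Prime) (h : p < m) : PrimesAbove p m :=
  ⟨hm.ne_zero, fun q hq hd => by rwa [(Nat.prime_dvd_prime_iff_eq hq hm).mp hd]⟩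

theorem coprime (hm : PrimesAbove p m) (hn : n ≠ 0) (h : n ≤ p) : m.Coprime n := by
  refine Nat.coprime_of_dvd fun q hq hqm hqn => ?_
  have := hm.2 q hq hqm
  have := Nat.le_of_dvd (Nat.pos_of_ne_zero hn) hqn
  omega

theorem odd (hp : p.Prime) (hm : PrimesAbove p m) : Odd m :=
  Nat.coprime_two_right.mp (hm.coprime two_ne_zero hp.two_le)

end PrimesAbove

/-! ### Transfer, and rigidity of cyclic groups -/

-- The transfer into a central subgroup of finite index is the power map with exponent the index.
open scoped IsMulCommutative in
theorem Subgroup.mul_pow_relIndex {G : Type*} [Group G] (H J : Subgroup G)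
    (h0 : H.relIndex J ≠ 0) (hc : ∀ x ∈ J, ∀ y ∈ H, x * y = y * x) {x y : G} (hx : x ∈ J)
    (hy : y ∈ J) : (x * y) ^ H.relIndex J = x ^ H.relIndex J * y ^ H.relIndex J := by
  set H' := H.subgroupOf J with hH'
  have : H'.FiniteIndex := ⟨h0⟩
  have hle : H' ≤ Subgroup.center J := by
    intro y hy
    rw [Subgroup.mem_center_iff]
    intro x
    exact Subtype.ext (hc x x.2 y hy)
  let ϕ : H' →* Subgroup.center J := Subgroup.inclusion hle
  have key : ∀ g : J, ∀ (k : ℕ) (g₀ : J), g₀⁻¹ * g ^ k * g₀ ∈ H' →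
      g₀⁻¹ * g ^ k * g₀ = g ^ k := by
    intro g k g₀ h
    have h1 := Subgroup.mem_center_iff.mp (hle h) g₀
    rw [← mul_left_inj g₀, ← h1]
    group
  have hmul := map_mul (MonoidHom.transfer (A := Subgroup.center J) ϕ) (⟨x, hx⟩ : J) ⟨y, hy⟩
  rw [MonoidHom.transfer_eq_pow ϕ _ (key _), MonoidHom.transfer_eq_pow ϕ _ (key _),
    MonoidHom.transfer_eq_pow ϕ _ (key _)] at hmul
  exact congrArg (fun z : Subgroup.center J => ((z : J) : G)) hmul

theorem AddSubgroup.nsmul_add_relIndex {G : Type*} [AddGroup G] (H J : AddSubgroup G)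
    (h0 : H.relIndex J ≠ 0) (hc : ∀ x ∈ J, ∀ y ∈ H, x + y = y + x) {x y : G}
    (hx : x ∈ J) (hy : y ∈ J) :
    H.relIndex J • (x + y) = H.relIndex J • x + H.relIndex J • y :=
  Subgroup.mul_pow_relIndex (AddSubgroup.toSubgroup H) (AddSubgroup.toSubgroup J) h0 hc hx hy

/-- An endomorphism that maps a cyclic subgroup into itself and whose order on it is prime to that
of the automorphism group fixes the generator. -/
theorem AddMonoidHom.fixes_of_iterate_fixes {A : Type*} [AddGroup A] (φ : A →+ A) {g : A}
    (hφ : φ g ∈ AddSubgroup.zmultiples g) {n : ℕ} (hn0 : n ≠ 0) (hn : φ^[n] g = g)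
    (h : addOrderOf g = 0 ∧ Odd n ∨
      (addOrderOf g).Prime ∧ n.Coprime (addOrderOf g - 1)) : φ g = g := by
  obtain ⟨k, hk⟩ := AddSubgroup.mem_zmultiples_iff.mp hφ
  have hit : ∀ j : ℕ, φ^[j] g = k ^ j • g := by
    intro j
    induction j with
    | zero => simp
    | succ j ih => rw [Function.iterate_succ_apply', ih, map_zsmul, ← hk, ← mul_zsmul', pow_succ']
  rw [hit n] at hn
  have hd : (addOrderOf g : ℤ) ∣ k ^ n - 1 := by
    rw [addOrderOf_dvd_iff_zsmul_eq_zero, sub_zsmul, hn, one_zsmul, add_neg_cancel]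
  suffices (addOrderOf g : ℤ) ∣ k - 1 by
    rw [addOrderOf_dvd_iff_zsmul_eq_zero, sub_zsmul, one_zsmul, hk] at this
    exact add_neg_eq_zero.mp this
  rcases h with ⟨h0, hodd⟩ | ⟨hq, hcop⟩
  · rw [h0, Nat.cast_zero, zero_dvd_iff, sub_eq_zero] at hd ⊢
    exact hodd.strictMono_pow.injective (by simpa using hd)
  -- The multiplier `k` is a unit modulo the prime order, and its multiplicative order divides both
  -- `n` and that prime minus one.
  · have : Fact (addOrderOf g).Prime := ⟨hq⟩
    rw [← ZMod.intCast_zmod_eq_zero_iff_dvd] at hd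
    rw [← ZMod.intCast_zmod_eq_zero_iff_dvd]
    push_cast at hd ⊢
    rw [sub_eq_zero] at hd ⊢
    have hk0 : (k : ZMod (addOrderOf g)) ≠ 0 := by
      intro h0
      rw [h0, zero_pow hn0] at hd
      exact zero_ne_one hd
    have h1 := orderOf_dvd_of_pow_eq_one hd
    have h2 := orderOf_dvd_of_pow_eq_one (ZMod.pow_card_sub_one_eq_one hk0)
    exact orderOf_eq_one_iff.mp (Nat.dvd_one.mp (hcop.gcd_eq_one ▸ Nat.dvd_gcd h1 h2))

/-! ### Identities for `λ` and additive conjugation -/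

namespace SkewLeftBrace

variable {B : Type*} [SkewLeftBrace B]

theorem mul_eq_add_lam (a b : B) : a * b = a + lam a b := by
  rw [lam, add_neg_cancel_left]

theorem lam_mul (a b c : B) : lam (a * b) c = lam a (lam b c) := by
  rw [lam, lam, lam, brace_mul_add, mul_assoc, ← neg_add_eq_zero]
  have h : a * -b = a + -(a * b) + a := by
    have := lam_neg a b
    rw [lam, lam, neg_add_rev, neg_neg] at this
    rw [add_assoc, ← this, add_neg_cancel_left]
  simp [h, add_assoc]

theorem lam_one (b : B) : lam 1 b = b := by
  rw [lam, one_mul, ← zero_eq_one_brace, neg_zero, zero_add]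

/-- The lambda map of `a`, as an endomorphism of the additive group. -/
def lamHom (a : B) : B →+ B where
  toFun := lam a
  map_zero' := lam_zero a
  map_add' := lam_add a

@[simp]
theorem lamHom_apply (a b : B) : lamHom a b = lam a b := rfl

theorem lam_nsmul (a b : B) (n : ℕ) : lam a (n • b) = n • lam a b :=
  map_nsmul (lamHom a) n b

theorem lamHom_iterate (a b : B) (n : ℕ) : (lamHom a)^[n] b = lam (a ^ n) b := by
  induction n with
  | zero => rw [pow_zero, lam_one, Function.iterate_zero, id]
  | succ n ih => rw [Function.iterate_succ_apply', ih, pow_succ', lam_mul, lamHom_apply]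

/-- Conjugation by `b` in the additive group. -/
def addConjHom (b : B) : B →+ B where
  toFun x := b + x + -b
  map_zero' := by simp
  map_add' := by simp [add_assoc]

@[simp]
theorem addConjHom_apply (b x : B) : addConjHom b x = b + x + -b := rfl

theorem addConjHom_iterate (b x : B) (n : ℕ) :
    (addConjHom b)^[n] x = n • b + x + -(n • b) := by
  induction n with
  | zero => simp
  | succ n ih =>
    rw [Function.iterate_succ_apply', ih, succ_nsmul', addConjHom_apply]
    simp [add_assoc]

/-! ### Ideals of a brace and of its quotients -/

namespace BraceIdeal

/-- A subgroup of the additive group, invariant under all `λ_b` and normal in both groups, is an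
ideal. -/
def ofAddSubgroup (A : AddSubgroup B) (hlam : ∀ b x : B, x ∈ A → lam b x ∈ A)
    (hadd : ∀ b x : B, x ∈ A → b + x + -b ∈ A) (hmul : ∀ b x : B, x ∈ A → b * x * b⁻¹ ∈ A) :
    BraceIdeal B where
  toAddSubgroup := A
  mul_mem' {a b} ha hb := by
    change a * b ∈ A
    rw [mul_eq_add_lam]
    exact A.add_mem ha (hlam _ _ hb)
  one_mem' := by
    change (1 : B) ∈ A
    rw [← zero_eq_one_brace]
    exact A.zero_mem
  inv_mem' {a} ha := by
    change a⁻¹ ∈ A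
    -- At `b = 0` this gives `a⁻¹ = -λ_{a⁻¹}(a)`.
    have h := lam_inv_neg_add a 0
    rw [add_zero, lam_neg, mul_zero_brace] at h
    rw [← h]
    exact A.neg_mem (hlam _ _ ha)
  lam_mem := hlam
  add_conj_mem := hadd
  mul_conj_mem := hmul

variable (I : BraceIdeal B)

theorem mem_carrier {x : B} : x ∈ I.carrier ↔ x ∈ I.add := Iff.rfl

/-- The additive and multiplicative indices of ideals agree. -/
theorem relIndex_mul_eq (I J : BraceIdeal B) : I.mul.relIndex J.mul = I.add.relIndex J.add := by
  refine Nat.card_congr (Quotient.congr (Equiv.refl _) fun a b => ?_)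
  exact ((QuotientGroup.leftRel_apply (s := I.mul.subgroupOf J.mul)).trans (I.inv_mul_mem_iff (a : B) b)).trans
    (QuotientAddGroup.leftRel_apply (s := I.add.addSubgroupOf J.add)).symm

theorem lam_proj (a b : B) : lam (I.proj a) (I.proj b) = I.proj (lam a b) := by
  simp only [lam, map_add, map_neg, proj_mul]

theorem proj_eq_zero_iff {a : B} : I.proj a = 0 ↔ a ∈ I.add :=
  QuotientAddGroup.eq_zero_iff a

theorem ker_proj : I.proj.ker = I.add := by
  ext a
  exact I.proj_eq_zero_iff

/-- The projection onto the quotient, as a homomorphism of multiplicative groups. -/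
def mulProj : B →* I.Quotient where
  toFun := I.proj
  map_one' := I.proj_one
  map_mul' := I.proj_mul

theorem proj_pow (a : B) (n : ℕ) : I.proj (a ^ n) = I.proj a ^ n :=
  map_pow I.mulProj a n

/-- The image of an ideal in a quotient. -/
def map (J : BraceIdeal B) : BraceIdeal I.Quotient :=
  ofAddSubgroup (J.add.map I.proj)
    (by
      rintro b _ ⟨x, hx, rfl⟩
      obtain ⟨b, rfl⟩ := I.proj_surjective b
      exact ⟨lam b x, J.lam_mem b x hx, (I.lam_proj b x).symm⟩)
    (by
      rintro b _ ⟨x, hx, rfl⟩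
      obtain ⟨b, rfl⟩ := I.proj_surjective b
      exact ⟨b + x + -b, J.add_conj_mem b x hx, by simp⟩)
    (by
      rintro b _ ⟨x, hx, rfl⟩
      obtain ⟨b, rfl⟩ := I.proj_surjective b
      exact ⟨b * x * b⁻¹, J.mul_conj_mem b x hx, by simp [proj_mul, proj_inv]⟩)

theorem map_add_eq (J : BraceIdeal B) : (I.map J).add = J.add.map I.proj := rfl

theorem proj_mem_map_iff {J : BraceIdeal B} (h : I.add ≤ J.add) {x : B} :
    I.proj x ∈ (I.map J).add ↔ x ∈ J.add := by
  rw [map_add_eq, ← AddSubgroup.mem_comap, AddSubgroup.comap_map_eq, ker_proj, sup_eq_left.mpr h]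

/-- The preimage of an ideal of a quotient. -/
def comap (T : BraceIdeal I.Quotient) : BraceIdeal B :=
  ofAddSubgroup (T.add.comap I.proj)
    (by
      intro b x hx
      rw [AddSubgroup.mem_comap, ← lam_proj]
      exact T.lam_mem _ _ hx)
    (by
      intro b x hx
      rw [AddSubgroup.mem_comap, map_add, map_add, map_neg]
      exact T.add_conj_mem _ _ hx)
    (by
      intro b x hx
      rw [AddSubgroup.mem_comap, proj_mul, proj_mul, proj_inv]
      exact T.mul_conj_mem _ _ hx)

theorem mem_comap_iff {T : BraceIdeal I.Quotient} {x : B} :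
    x ∈ (I.comap T).add ↔ I.proj x ∈ T.add := Iff.rfl

theorem relIndex_comap (T : BraceIdeal I.Quotient) :
    I.add.relIndex (I.comap T).add = Nat.card T.add := by
  have h : (I.comap T).add = T.add.comap I.proj := rfl
  rw [h, ← I.ker_proj, AddSubgroup.relIndex_ker,
    AddSubgroup.map_comap_eq_self_of_surjective I.proj_surjective]

theorem relIndex_map_map {J K : BraceIdeal B} (hK : I.add ≤ K.add) (hJ : I.add ≤ J.add) :
    (I.map K).add.relIndex (I.map J).add = K.add.relIndex J.add := by
  rw [map_add_eq, map_add_eq, AddSubgroup.relIndex_map_map, ker_proj, sup_eq_left.mpr hK,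
    sup_eq_left.mpr hJ]

/-! ### Descending past one cyclic factor -/

/-- `J` consists of the elements that are torsion modulo `K`, with order divisible only by primes
greater than `p`, for both group structures. -/
structure IsTorsionAbove (p : ℕ) (K J : BraceIdeal B) : Prop where
  le : K.add ≤ J.add
  relIndex : PrimesAbove p (K.add.relIndex J.add)
  mem_of_nsmul_mem : ∀ {m x}, PrimesAbove p m → m • x ∈ K.add → x ∈ J.add
  mem_of_pow_mem : ∀ {m x}, PrimesAbove p m → x ^ m ∈ K.add → x ∈ J.add

theorem pow_relIndex_mem (K J : BraceIdeal B) {x : B} (hx : x ∈ J.add) :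
    x ^ K.add.relIndex J.add ∈ K.add := by
  rw [← relIndex_mul_eq]
  exact K.mul.pow_relIndex_mem (K := J.mul) hx

/-- If `J` centralises `K` and acts trivially on it, then multiplication by `|J : K|` is a
homomorphism from both groups of `J` to `K`, and its kernel is the required torsion ideal. -/
theorem IsTorsionAbove.exists_of_trivial_action {p : ℕ} {K J Z : BraceIdeal B}
    (h : IsTorsionAbove p K J) (hZ : Z.carrier = {0})
    (hadd : ∀ x ∈ J.add, ∀ y ∈ K.add, x + y = y + x)
    (hlam : ∀ x ∈ J.add, ∀ y ∈ K.add, lam x y = y)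
    (htor : ∀ y ∈ K.add, ∀ n, PrimesAbove p n → n • y = 0 → y = 0) :
    ∃ T : BraceIdeal B, IsTorsionAbove p Z T := by
  have hZ' : Z.add = ⊥ := SetLike.coe_injective hZ
  set m := K.add.relIndex J.add with hm
  have hmK : ∀ {x}, x ∈ J.add → m • x ∈ K.add := fun hx => K.add.nsmul_relIndex_mem hx
  have hfadd : ∀ {x y}, x ∈ J.add → y ∈ J.add → m • (x + y) = m • x + m • y :=
    fun hx hy => AddSubgroup.nsmul_add_relIndex K.add J.add h.relIndex.1 hadd hx hy
  have hfmul : ∀ {x y}, x ∈ J.add → y ∈ J.add → m • (x * y) = m • x + m • y := by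
    intro x y hx hy
    rw [mul_eq_add_lam, hfadd hx (J.lam_mem _ _ hy), ← lam_nsmul, hlam x hx _ (hmK hy)]
  have hpowJ : ∀ {x}, x ∈ J.add → ∀ n : ℕ, x ^ n ∈ J.add := fun hx n => J.mul.pow_mem hx n
  have hfpow : ∀ {x}, x ∈ J.add → ∀ n : ℕ, m • (x ^ n) = n • (m • x) := by
    intro x hx n
    induction n with
    | zero => rw [pow_zero, ← zero_eq_one_brace, nsmul_zero, zero_nsmul]
    | succ n ih => rw [pow_succ, hfmul (hpowJ hx n) hx, ih, succ_nsmul]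
  have add_iff : ∀ {x n}, PrimesAbove p n → n • x = 0 → x ∈ J.add ∧ m • x = 0 := by
    intro x n hn hx
    have hxJ : x ∈ J.add := h.mem_of_nsmul_mem hn (hx ▸ K.add.zero_mem)
    refine ⟨hxJ, htor _ (hmK hxJ) n hn ?_⟩
    rw [← mul_nsmul', mul_comm, mul_nsmul', hx, nsmul_zero]
  have mul_iff : ∀ {x n}, PrimesAbove p n → x ^ n = 1 → x ∈ J.add ∧ m • x = 0 := by
    intro x n hn hx
    have hxJ : x ∈ J.add :=
      h.mem_of_pow_mem hn (by rw [hx, ← zero_eq_one_brace]; exact K.add.zero_mem)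
    refine ⟨hxJ, htor _ (hmK hxJ) n hn ?_⟩
    rw [← hfpow hxJ, hx, ← zero_eq_one_brace, nsmul_zero]
  have pow_eq : ∀ {x}, x ∈ J.add → m • x = 0 → x ^ m = 1 := by
    intro x hxJ hx
    rw [← zero_eq_one_brace]
    -- `x ^ m` lies in `K`, which has no such torsion, and `m • x ^ m = m • (m • x) = 0`.
    refine htor _ (pow_relIndex_mem K J hxJ) m h.relIndex ?_
    rw [hfpow hxJ, hx, nsmul_zero]
  let A : AddSubgroup B :=
    { carrier := {x | x ∈ J.add ∧ m • x = 0}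
      zero_mem' := ⟨J.add.zero_mem, nsmul_zero m⟩
      add_mem' := fun {x y} hx hy =>
        ⟨J.add.add_mem hx.1 hy.1, by rw [hfadd hx.1 hy.1, hx.2, hy.2, add_zero]⟩
      neg_mem' := fun {x} hx => ⟨J.add.neg_mem hx.1, by rw [neg_nsmul, hx.2, neg_zero]⟩ }
  let T : BraceIdeal B := ofAddSubgroup A
    (fun b x hx => ⟨J.lam_mem _ _ hx.1, by rw [← lam_nsmul, hx.2, lam_zero]⟩)
    (fun b x hx => ⟨J.add_conj_mem _ _ hx.1, by
      rw [← addConjHom_apply, ← map_nsmul, hx.2, map_zero]⟩)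
    -- Multiplicative normality: membership is equivalent to `x ^ m = 1`, a condition stable under
    -- conjugation.
    (fun b x hx => mul_iff h.relIndex (by rw [conj_pow, pow_eq hx.1 hx.2, mul_one, mul_inv_cancel]))
  have hTJ : T.add ≤ J.add := fun x hx => hx.1
  -- `T` meets `K` trivially, so it embeds in `J/K` and `|T|` divides `m`.
  have hcard : K.add.relIndex T.add = Nat.card T.add := by
    rw [← AddSubgroup.inf_relIndex_right, ← AddSubgroup.relIndex_bot_left]
    congr 1
    rw [eq_bot_iff]
    intro x hx
    exact htor x hx.1 m h.relIndex hx.2.2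
  refine ⟨T, ?_, ?_, ?_, ?_⟩
  · rw [hZ']
    exact bot_le
  · rw [hZ', AddSubgroup.relIndex_bot_left, ← hcard]
    refine h.relIndex.of_dvd ?_
    rw [← AddSubgroup.relIndex_addSubgroupOf hTJ]
    exact AddSubgroup.relIndex_dvd_index_of_normal _ _
  · intro n x hn hx
    rw [hZ', AddSubgroup.mem_bot] at hx
    exact add_iff hn hx
  · intro n x hn hx
    rw [hZ', AddSubgroup.mem_bot, zero_eq_one_brace] at hx
    exact mul_iff hn hx

theorem IsTorsionAbove.exists_of_card_eq_prime_gt {p q : ℕ} {K J Z : BraceIdeal B}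
    (h : IsTorsionAbove p K J) (hZ : Z.carrier = {0}) (hq : q.Prime) (hK : Nat.card K.add = q)
    (hpq : p < q) : IsTorsionAbove p Z J := by
  have hZ' : Z.add = ⊥ := SetLike.coe_injective hZ
  refine ⟨hZ' ▸ bot_le, ?_, fun hn hx => ?_, fun hn hx => ?_⟩
  · rw [hZ', ← AddSubgroup.relIndex_mul_relIndex ⊥ K.add J.add bot_le h.le,
      AddSubgroup.relIndex_bot_left, hK]
    exact (PrimesAbove.of_prime hq hpq).mul h.relIndex
  · rw [hZ'] at hx
    exact h.mem_of_nsmul_mem hn (bot_le (a := K.add) hx)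
  · rw [hZ'] at hx
    exact h.mem_of_pow_mem hn (bot_le (a := K.add) hx)

theorem eqOn_of_iterate {K : BraceIdeal B} {g : B} (hg : K.add = AddSubgroup.zmultiples g)
    (φ : B →+ B) (hφ : ∀ y ∈ K.add, φ y ∈ K.add) {n : ℕ} (hn0 : n ≠ 0) (hn : φ^[n] g = g)
    (h : addOrderOf g = 0 ∧ Odd n ∨
      (addOrderOf g).Prime ∧ n.Coprime (addOrderOf g - 1)) : ∀ y ∈ K.add, φ y = y := by
  intro y hy
  have hgK : g ∈ K.add := hg ▸ AddSubgroup.mem_zmultiples g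
  have := φ.fixes_of_iterate_fixes (hg ▸ hφ g hgK) hn0 hn h
  rw [hg] at hy
  obtain ⟨k, rfl⟩ := AddSubgroup.mem_zmultiples_iff.mp hy
  rw [map_zsmul, this]

theorem add_comm_of_zmultiples {K : BraceIdeal B} {g : B} (hg : K.add = AddSubgroup.zmultiples g)
    {x y : B} (hx : x ∈ K.add) (hy : y ∈ K.add) : x + y = y + x := by
  rw [hg] at hx hy
  obtain ⟨k, rfl⟩ := AddSubgroup.mem_zmultiples_iff.mp hx
  obtain ⟨l, rfl⟩ := AddSubgroup.mem_zmultiples_iff.mp hy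
  rw [← add_zsmul, add_comm, add_zsmul]

theorem exists_generator {K : BraceIdeal B} (h : IsAddCyclic K.add) :
    ∃ g : B, K.add = AddSubgroup.zmultiples g ∧ addOrderOf g = Nat.card K.add := by
  obtain ⟨g, hg⟩ := (AddSubgroup.isAddCyclic_iff_exists_zmultiples_eq_top _).mp h
  exact ⟨g, hg.symm, by rw [← hg, Nat.card_zmultiples]⟩

/-- The primes dividing `m` exceed `p ≥ q`, so `m` is prime to `|Aut K| = q - 1`, and `K` has no
torsion above `p`. -/
theorem IsTorsionAbove.exists_of_card_eq_prime_le {p q : ℕ} {K J Z : BraceIdeal B}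
    (h : IsTorsionAbove p K J) (hZ : Z.carrier = {0}) (hq : q.Prime) (hK : Nat.card K.add = q)
    (hqp : q ≤ p) : ∃ T : BraceIdeal B, IsTorsionAbove p Z T := by
  have : Fact q.Prime := ⟨hq⟩
  obtain ⟨g, hg, hgo⟩ := exists_generator (isAddCyclic_of_prime_card hK)
  rw [hK] at hgo
  have hgK : g ∈ K.add := hg ▸ AddSubgroup.mem_zmultiples g
  set m := K.add.relIndex J.add with hm
  have hcm : m.Coprime (q - 1) :=
    h.relIndex.coprime (by have := hq.two_le; omega) (by omega)
  have hcq : q.Coprime (q - 1) :=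
    (Nat.coprime_self_sub_right hq.one_le).mpr (Nat.coprime_one_right q)
  have hfin : Finite K.add := Nat.finite_of_card_ne_zero (hK ▸ hq.ne_zero)
  refine h.exists_of_trivial_action hZ ?_ ?_ ?_
  · intro x hx y hy
    have hfix := eqOn_of_iterate hg (addConjHom x) (K.add_conj_mem x) h.relIndex.1 (by
      rw [addConjHom_iterate, add_comm_of_zmultiples hg (K.add.nsmul_relIndex_mem hx) hgK,
        add_neg_cancel_right]) (Or.inr ⟨hgo ▸ hq, hgo ▸ hcm⟩) y hy
    rw [addConjHom_apply, add_neg_eq_iff_eq_add] at hfix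
    exact hfix
  · intro x hx y hy
    -- The exponent is `m * q`: `x ^ m` lies in `K`, whose multiplicative group has order `q`. The
    -- extra factor is still prime to `q - 1`.
    refine eqOn_of_iterate hg (lamHom x) (K.lam_mem x) (mul_ne_zero h.relIndex.1 hq.ne_zero) ?_
      (Or.inr ⟨hgo ▸ hq, hgo ▸ hcm.mul_left hcq⟩) y hy
    have h1 : (x ^ m) ^ q = 1 := by
      have h2 : (⟨x ^ m, pow_relIndex_mem K J hx⟩ : K.mul) ^ Nat.card K.mul = 1 := pow_card_eq_one'
      have h3 : Nat.card K.mul = q := hK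
      rw [h3] at h2
      exact congrArg Subtype.val h2
    rw [lamHom_iterate, pow_mul, h1, lam_one]
  · intro y hy n hn hny
    have h1 : q • y = 0 := by
      have h2 : Nat.card K.add • (⟨y, hy⟩ : K.add) = 0 := card_nsmul_eq_zero'
      rw [hK] at h2
      exact congrArg Subtype.val h2
    have hcop : n.Coprime q := hn.coprime hq.ne_zero hqp
    have h3 := Nat.dvd_gcd (addOrderOf_dvd_of_nsmul_eq_zero hny)
      (addOrderOf_dvd_of_nsmul_eq_zero h1)
    rw [hcop.gcd_eq_one, Nat.dvd_one] at h3
    exact AddMonoid.addOrderOf_eq_one_iff.mp h3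

/-- Since `x ^ m` lies in the socle, `λ_x` acts on `K` as an integer `k` with `k ^ m = 1`; as `m` is
odd, `k = 1`. -/
theorem IsTorsionAbove.exists_of_infinite_cyclic {p : ℕ} (hp : p.Prime) {K J Z : BraceIdeal B}
    (h : IsTorsionAbove p K J) (hZ : Z.carrier = {0}) (hc : IsAddCyclic K.add)
    (hinf : Infinite K.add) (hsoc : K.carrier ⊆ socle B) :
    ∃ T : BraceIdeal B, IsTorsionAbove p Z T := by
  obtain ⟨g, hg, hgo⟩ := exists_generator hc
  rw [Nat.card_eq_zero_of_infinite] at hgo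
  refine h.exists_of_trivial_action hZ ?_ ?_ ?_
  · intro x _ y hy
    exact ((hsoc hy).2 x).symm
  · intro x hx y hy
    refine eqOn_of_iterate hg (lamHom x) (K.lam_mem x) h.relIndex.1 ?_
      (Or.inl ⟨hgo, h.relIndex.odd hp⟩) y hy
    rw [lamHom_iterate]
    exact (hsoc (pow_relIndex_mem K J hx)).1 g
  · intro y hy n hn hny
    rw [hg] at hy
    obtain ⟨k, rfl⟩ := AddSubgroup.mem_zmultiples_iff.mp hy
    have h1 : ((n * k : ℤ)) • g = 0 := by
      rw [mul_comm, mul_zsmul', natCast_zsmul]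
      simpa [mul_zsmul, mul_comm] using hny
    rw [← addOrderOf_dvd_iff_zsmul_eq_zero, hgo, Nat.cast_zero, zero_dvd_iff, mul_eq_zero] at h1
    rcases h1 with h1 | h1
    · exact absurd (by exact_mod_cast h1) hn.1
    · rw [h1, zero_zsmul]

end BraceIdeal
end SkewLeftBrace

/-! ### A Sylow subgroup over a normal subgroup -/

/-- The index of `N ⊔ P` in `W` divides `|W : N|`, a power of `q`, and also `|G : P|`, which is
prime to `q`. -/
theorem Subgroup.le_sup_sylow {G : Type*} [Group G] [Finite G] {q : ℕ} [hq : Fact q.Prime]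
    (N W : Subgroup G) [N.Normal] (hNW : N ≤ W) (P : Sylow q G)
    (hPW : (P : Subgroup G) ≤ W) (hW : ∀ x ∈ W, ∃ a : ℕ, x ^ q ^ a ∈ N) : W ≤ N ⊔ P := by
  have hpg : IsPGroup q (W ⧸ N.subgroupOf W) := by
    intro x
    obtain ⟨x, rfl⟩ := QuotientGroup.mk_surjective x
    obtain ⟨a, ha⟩ := hW x x.2
    exact ⟨a, by rw [← QuotientGroup.mk_pow, QuotientGroup.eq_one_iff]; exact ha⟩
  obtain ⟨c, hc⟩ := hpg.exists_card_eq
  have h1 : (N ⊔ P).relIndex W ∣ q ^ c := by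
    rw [← hc]
    exact Subgroup.relIndex_dvd_of_le_left W le_sup_left
  have h2 : (N ⊔ (P : Subgroup G)).relIndex W ∣ (P : Subgroup G).index :=
    (Subgroup.relIndex_dvd_index_of_le (sup_le hNW hPW)).trans
      (Subgroup.index_dvd_of_le le_sup_right)
  have hcop : (q ^ c).Coprime (P : Subgroup G).index :=
    Nat.Coprime.pow_left c ((Nat.Prime.coprime_iff_not_dvd hq.out).mpr P.not_dvd_index)
  rw [← Subgroup.relIndex_eq_one]
  exact Nat.dvd_one.mp (hcop.gcd_eq_one ▸ Nat.dvd_gcd h1 h2)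

/-! ### Induction down the chain and the sets `UAdd`, `UMul` -/

namespace SkewLeftBrace

variable {B : Type*} [SkewLeftBrace B]

namespace BraceIdeal

theorem IsTorsionAbove.exists_of_factor {p : ℕ} (hp : p.Prime) {I K J : BraceIdeal B}
    (h : IsTorsionAbove p K J) (hIK : I.add ≤ K.add)
    (hfac : (IsAddCyclic (I.factor K) ∧ Infinite (I.factor K) ∧
        (I.factor K : Set I.Quotient) ⊆ socle I.Quotient) ∨ (Nat.card (I.factor K)).Prime) :
    ∃ T : BraceIdeal B, IsTorsionAbove p I T := by
  have hIJ := hIK.trans h.le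
  have h' : IsTorsionAbove p (I.map K) (I.map J) := by
    refine ⟨AddSubgroup.map_mono h.le, ?_, fun {m x} hm hx => ?_, fun {m x} hm hx => ?_⟩
    · rw [I.relIndex_map_map hIK hIJ]
      exact h.relIndex
    · obtain ⟨x, rfl⟩ := I.proj_surjective x
      rw [← map_nsmul, I.proj_mem_map_iff hIK] at hx
      rw [I.proj_mem_map_iff hIJ]
      exact h.mem_of_nsmul_mem hm hx
    · obtain ⟨x, rfl⟩ := I.proj_surjective x
      rw [← proj_pow, I.proj_mem_map_iff hIK] at hx
      rw [I.proj_mem_map_iff hIJ]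
      exact h.mem_of_pow_mem hm hx
  have hZ : (I.map I).carrier = {0} := by
    ext x
    obtain ⟨x, rfl⟩ := I.proj_surjective x
    rw [mem_carrier, I.proj_mem_map_iff le_rfl, Set.mem_singleton_iff, I.proj_eq_zero_iff]
  have hZ' : (I.map I).add = ⊥ := SetLike.coe_injective hZ
  obtain ⟨T, hT⟩ : ∃ T, IsTorsionAbove p (I.map I) T := by
    rcases hfac with ⟨hc, hinf, hsoc⟩ | hq
    · exact h'.exists_of_infinite_cyclic hp hZ hc hinf hsoc
    · rcases lt_or_ge p (Nat.card (I.factor K)) with hpq | hqp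
      · exact ⟨_, h'.exists_of_card_eq_prime_gt hZ hq rfl hpq⟩
      · exact h'.exists_of_card_eq_prime_le hZ hq rfl hqp
  refine ⟨I.comap T, ?_, ?_, fun {m x} hm hx => ?_, fun {m x} hm hx => ?_⟩
  · intro x hx
    rw [mem_comap_iff, I.proj_eq_zero_iff.mpr hx]
    exact T.add.zero_mem
  · rw [relIndex_comap, ← AddSubgroup.relIndex_bot_left, ← hZ']
    exact hT.relIndex
  · refine hT.mem_of_nsmul_mem hm ?_
    rwa [← map_nsmul, I.proj_mem_map_iff le_rfl]
  · refine hT.mem_of_pow_mem hm ?_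
    rwa [← proj_pow, I.proj_mem_map_iff le_rfl]

end BraceIdeal

open BraceIdeal

theorem mem_UAdd_iff {p : ℕ} {x : B} : x ∈ UAdd B p ↔ PrimesAbove p (addOrderOf x) :=
  and_congr_left' addOrderOf_ne_zero_iff.symm

theorem mem_UMul_iff {p : ℕ} {x : B} : x ∈ UMul B p ↔ PrimesAbove p (orderOf x) :=
  and_congr_left' orderOf_ne_zero_iff.symm

theorem BraceIdeal.IsTorsionAbove.carrier_eq_UAdd {p : ℕ} {Z T : BraceIdeal B}
    (h : IsTorsionAbove p Z T) (hZ : Z.carrier = {0}) : T.carrier = UAdd B p := by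
  have hZ' : Z.add = ⊥ := SetLike.coe_injective hZ
  ext x
  rw [mem_UAdd_iff]
  refine ⟨fun hx => h.relIndex.of_dvd (addOrderOf_dvd_of_nsmul_eq_zero ?_),
    fun hx => h.mem_of_nsmul_mem hx ?_⟩
  · rw [← AddSubgroup.mem_bot, ← hZ']
    exact Z.add.nsmul_relIndex_mem (K := T.add) hx
  · rw [addOrderOf_nsmul_eq_zero]
    exact Z.add.zero_mem

theorem BraceIdeal.IsTorsionAbove.carrier_eq_UMul {p : ℕ} {Z T : BraceIdeal B}
    (h : IsTorsionAbove p Z T) (hZ : Z.carrier = {0}) : T.carrier = UMul B p := by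
  have hZ' : Z.add = ⊥ := SetLike.coe_injective hZ
  ext x
  rw [mem_UMul_iff]
  refine ⟨fun hx => h.relIndex.of_dvd (orderOf_dvd_of_pow_eq_one ?_),
    fun hx => h.mem_of_pow_mem hx ?_⟩
  · rw [← zero_eq_one_brace, ← AddSubgroup.mem_bot, ← hZ']
    exact Z.pow_relIndex_mem T hx
  · rw [pow_orderOf_eq_one, ← zero_eq_one_brace]
    exact Z.add.zero_mem

theorem IsSupersoluble.exists_isTorsionAbove (hB : IsSupersoluble B) {p : ℕ} (hp : p.Prime) :
    ∃ Z T : BraceIdeal B, Z.carrier = {0} ∧ IsTorsionAbove p Z T := by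
  obtain ⟨n, I, h0, hn, hI⟩ := hB
  suffices ∀ k ≤ n, ∃ T, IsTorsionAbove p (I k) T by
    obtain ⟨T, hT⟩ := this 0 n.zero_le
    exact ⟨I 0, T, h0, hT⟩
  intro k hk
  induction hk using Nat.decreasingInduction with
  | self =>
    have hmem : ∀ x, x ∈ (I n).add := fun x => by rw [← mem_carrier, hn]; trivial
    refine ⟨I n, le_rfl, ?_, fun _ _ => hmem _, fun _ _ => hmem _⟩
    rw [AddSubgroup.relIndex_self]
    exact PrimesAbove.one
  | of_succ k hk ih =>
    obtain ⟨J, hJ⟩ := ih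
    exact hJ.exists_of_factor hp (hI k hk).1 (hI k hk).2

theorem IsSupersoluble.UAdd_eq_UMul (hB : IsSupersoluble B) {p : ℕ} (hp : p.Prime) :
    UAdd B p = UMul B p := by
  obtain ⟨Z, T, hZ, hT⟩ := hB.exists_isTorsionAbove hp
  rw [← hT.carrier_eq_UAdd hZ, hT.carrier_eq_UMul hZ]

theorem IsSupersoluble.isBraceIdeal_UAdd (hB : IsSupersoluble B) {p : ℕ} (hp : p.Prime) :
    IsBraceIdeal (UAdd B p) := by
  obtain ⟨Z, T, hZ, hT⟩ := hB.exists_isTorsionAbove hp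
  exact ⟨T, hT.carrier_eq_UAdd hZ⟩

theorem odd_addOrderOf_iff_mem_UAdd {x : B} : Odd (addOrderOf x) ↔ x ∈ UAdd B 2 := by
  rw [mem_UAdd_iff]
  refine ⟨fun h => ⟨fun h0 => ?_, fun q hq hd => ?_⟩, fun h => h.odd Nat.prime_two⟩
  -- Infinite order is encoded as `0`, which is even.
  · rw [h0] at h
    exact absurd h (by decide)
  · refine lt_of_le_of_ne hq.two_le ?_
    rintro rfl
    exact Nat.not_even_iff_odd.mpr h (even_iff_two_dvd.mpr hd)

/-! ### Sums of Sylow subgroups -/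

variable {n : ℕ} {q : Fin n → ℕ}

/-- The elements whose additive order is divisible only by the first `k` of the primes `q i`. -/
def hallSet (B : Type*) [SkewLeftBrace B] (q : Fin n → ℕ) (k : ℕ) : Set B :=
  {x | ∀ r : ℕ, r.Prime → r ∣ addOrderOf x → ∃ i : Fin n, i.val < k ∧ q i = r}

/-- As `q` decreases, indices below `k` mean primes above `q k`, so the set is `UAdd B (q k)`. For
`k = n` there is no such prime, but the set is all of `B`. -/
theorem IsSupersoluble.isBraceIdeal_hallSet [Finite B] (hB : IsSupersoluble B) (hq : StrictAnti q)
    (hr : Set.range q = ((Nat.card B).primeFactors : Set ℕ)) {k : ℕ} (hk : k ≤ n) :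
    IsBraceIdeal (hallSet B q k) := by
  have hprime : ∀ i, (q i).Prime := fun i =>
    Nat.prime_of_mem_primeFactors (Finset.mem_coe.mp (hr ▸ Set.mem_range_self i))
  have hex : ∀ x : B, ∀ r : ℕ, r.Prime → r ∣ addOrderOf x → ∃ i, q i = r := by
    intro x r hrp hd
    have : r ∈ Set.range q := by
      rw [hr, Finset.mem_coe]
      exact Nat.mem_primeFactors.mpr ⟨hrp, hd.trans (addOrderOf_dvd_natCard x), Nat.card_pos.ne'⟩
    exact this
  rcases hk.lt_or_eq with hk | rfl
  · convert hB.isBraceIdeal_UAdd (hprime ⟨k, hk⟩) using 1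
    ext x
    rw [mem_UAdd_iff]
    refine ⟨fun h => ⟨(addOrderOf_pos x).ne', fun r hrp hd => ?_⟩, fun h r hrp hd => ?_⟩
    · obtain ⟨i, hi, rfl⟩ := h r hrp hd
      exact hq hi
    · obtain ⟨i, rfl⟩ := hex x r hrp hd
      exact ⟨i, hq.lt_iff_gt.mp (h.2 _ hrp hd), rfl⟩
  · obtain ⟨m, I, -, hI, -⟩ := hB
    refine ⟨I m, hI.trans (Set.eq_univ_of_forall fun x r hrp hd => ?_).symm⟩
    obtain ⟨i, hi⟩ := hex x r hrp hd
    exact ⟨i, i.2, hi⟩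

theorem hallSet_zero : hallSet B q 0 = {0} := by
  ext x
  rw [Set.mem_singleton_iff, ← AddMonoid.addOrderOf_eq_one_iff]
  constructor
  · intro h
    by_contra hne
    obtain ⟨r, hrp, hd⟩ := Nat.exists_prime_and_dvd hne
    obtain ⟨i, hi, -⟩ := h r hrp hd
    exact absurd hi (Nat.not_lt_zero _)
  · intro h r hrp hd
    rw [h] at hd
    exact absurd (Nat.dvd_one.mp hd) hrp.ne_one

theorem hallSet_mono {k l : ℕ} (h : k ≤ l) : hallSet B q k ⊆ hallSet B q l := by
  intro x hx r hrp hd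
  obtain ⟨i, hi, hir⟩ := hx r hrp hd
  exact ⟨i, hi.trans_le h, hir⟩

theorem addSylowSet_subset_hallSet (hq : ∀ i, (q i).Prime) (i : Fin n)
    (P : Sylow (q i) (Multiplicative B)) : addSylowSet P ⊆ hallSet B q (i + 1) := by
  intro x hx r hrp hd
  obtain ⟨a, ha⟩ := P.isPGroup' ⟨Multiplicative.ofAdd x, hx⟩
  have hax : q i ^ a • x = 0 := congrArg (fun y => Multiplicative.toAdd y.val) ha
  have := hrp.dvd_of_dvd_pow (hd.trans (addOrderOf_dvd_of_nsmul_eq_zero hax))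
  exact ⟨i, Nat.lt_succ_self _, ((Nat.prime_dvd_prime_iff_eq hrp (hq i)).mp this).symm⟩

theorem exists_nsmul_mem_hallSet [Finite B] (i : Fin n) {x : B} (hq : (q i).Prime)
    (hx : x ∈ hallSet B q (i + 1)) : ∃ a : ℕ, q i ^ a • x ∈ hallSet B q i := by
  -- `q i ^ a` is the full `q i`-part of the order of `x`.
  obtain ⟨a, m, hm, ho⟩ := Nat.exists_eq_pow_mul_and_not_dvd (addOrderOf_pos x).ne' (q i) hq.ne_one
  refine ⟨a, fun r hrp hd => ?_⟩
  have hdm : addOrderOf (q i ^ a • x) ∣ m := by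
    rw [addOrderOf_dvd_iff_nsmul_eq_zero, ← mul_nsmul, ← ho, addOrderOf_nsmul_eq_zero]
  obtain ⟨j, hj, rfl⟩ := hx r hrp ((hd.trans hdm).trans (ho ▸ Dvd.intro_left _ rfl))
  refine ⟨j, lt_of_le_of_ne (Nat.lt_succ_iff.mp hj) fun hji => hm ?_, rfl⟩
  rw [← Fin.ext hji]
  exact hd.trans hdm

theorem hallSet_succ [Finite B] (hq : ∀ i, (q i).Prime) (i : Fin n)
    (P : Sylow (q i) (Multiplicative B)) (h : IsBraceIdeal (hallSet B q i))
    (h' : IsBraceIdeal (hallSet B q (i + 1))) :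
    hallSet B q (i + 1) = hallSet B q i + addSylowSet P := by
  have : Fact (q i).Prime := ⟨hq i⟩
  obtain ⟨V, hV⟩ := h
  obtain ⟨W, hW⟩ := h'
  apply Set.Subset.antisymm
  · have hN : (AddSubgroup.toSubgroup V.add).Normal := ⟨fun x hx b => V.add_conj_mem b x hx⟩
    have hle := Subgroup.le_sup_sylow (AddSubgroup.toSubgroup V.add) (AddSubgroup.toSubgroup W.add)
      (show V.carrier ⊆ W.carrier by rw [hV, hW]; exact hallSet_mono (Nat.le_succ _)) P
      (fun x hx => show x ∈ W.carrier from hW ▸ addSylowSet_subset_hallSet hq i P hx)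
      (fun x hx => by
        obtain ⟨a, ha⟩ := exists_nsmul_mem_hallSet i (x := x.toAdd) (hq i) (hW ▸ hx)
        exact ⟨a, by rw [← hV] at ha; exact ha⟩)
    intro x hx
    rw [← hW] at hx
    have hx' := hle (show Multiplicative.ofAdd x ∈ AddSubgroup.toSubgroup W.add from hx)
    -- Normality of the first factor turns the join into the set of sums.
    rw [← SetLike.mem_coe, Subgroup.normal_mul] at hx'
    obtain ⟨v, hv, y, hy, hvy⟩ := hx'
    exact ⟨v.toAdd, hV ▸ hv, y.toAdd, hy, hvy⟩
  · rintro _ ⟨v, hv, y, hy, rfl⟩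
    have hv' := hallSet_mono (Nat.le_succ _) hv
    have hy' := addSylowSet_subset_hallSet hq i P hy
    rw [← hW] at hv' hy' ⊢
    exact W.add.add_mem hv' hy'

theorem sum_take_addSylowSet [Finite B] (hq : ∀ i, (q i).Prime)
    (P : (i : Fin n) → Sylow (q i) (Multiplicative B))
    (h : ∀ k ≤ n, IsBraceIdeal (hallSet B q k)) {k : ℕ} (hk : k ≤ n) :
    ((List.ofFn fun i => addSylowSet (P i)).take k).sum = hallSet B q k := by
  induction k with
  | zero => rw [List.take_zero, List.sum_nil, hallSet_zero, Set.singleton_zero]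
  | succ k ih =>
    rw [List.sum_take_succ _ _ (by simpa using hk), ih (by omega), List.getElem_ofFn]
    exact (hallSet_succ hq ⟨k, hk⟩ (P ⟨k, hk⟩) (h k (by omega)) (h (k + 1) hk)).symm

end SkewLeftBrace

open SkewLeftBrace in
theorem corollary3p10 (B : Type*) [SkewLeftBrace B] (hB : IsSupersoluble B) :
    (∀ p : ℕ, p.Prime → UAdd B p = UMul B p ∧ IsBraceIdeal (UAdd B p)) ∧
    (Finite B →
      ∀ (n : ℕ) (q : Fin n → ℕ), StrictAnti q →
        Set.range q = ((Nat.card B).primeFactors : Set ℕ) →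
        ∀ P : (i : Fin n) → Sylow (q i) (Multiplicative B),
        ∀ k ≤ n, IsBraceIdeal ((List.ofFn fun i => addSylowSet (P i)).take k).sum) ∧
    IsBraceIdeal {x : B | Odd (addOrderOf x)} := by
  refine ⟨fun p hp => ⟨hB.UAdd_eq_UMul hp, hB.isBraceIdeal_UAdd hp⟩, ?_, ?_⟩
  · intro _ n q hq hr P k hk
    have hprime : ∀ i, (q i).Prime := fun i =>
      Nat.prime_of_mem_primeFactors (Finset.mem_coe.mp (hr ▸ Set.mem_range_self i))
    have hideal : ∀ k ≤ n, IsBraceIdeal (hallSet B q k) :=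
      fun k hk => hB.isBraceIdeal_hallSet hq hr hk
    rw [sum_take_addSylowSet hprime P hideal hk]
    exact hideal k hk
  · simp only [odd_addOrderOf_iff_mem_UAdd, Set.ofPred_mem_eq]
    exact hB.isBraceIdeal_UAdd Nat.prime_two
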